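/- Let $\mathcal A=\prod_{j=1}^\infty\{1,\dots,L_j\}$ with the product topology, coordinate variables $X_j(a)=a_j$, Borel $\sigma$-algebra $\mathcal B(\mathcal A)$ and tail $\sigma$-algebra $\mathcal X=\bigcap_n\sigma(X_n,X_{n+1},\dots)$. Let $P$ be the set of all $\beta=(\beta_{jl})_{j\ge 1,\,1\le l\le L_j}\in\mathbb R^\infty$ with $0\le\beta_{jl}\le 1$ and $\sum_{l}\beta_{jl}=1$ for every $j$. For $\beta\in P$ let $\mathsf P_\beta$ be the distribution on $\mathcal A$ under which the $X_j$ are independent with $\mathsf P_\beta(X_j=l)=\beta_{jl}$. Let $\lambda^1,\dots,\lambda^K\in P$ be linearly independent with linear span $\mathcal L$, let $Q=\{g\in\mathbb R^K:\sum_k g_k\lambda^k\in P\cap\mathcal L\}$ with the Euclidean topology, and write $\mathsf P_g=\mathsf P_{\beta(g)}$, where $\beta(g)=\sum_k g_k\lambda^k$, for $g\in Q$. For a Borel probability measure $\mu$ on $Q$ put $\mathsf P_\mu(A)=\int_Q\mathsf P_g(A)\,\mu(dg)$ for $A\in\mathcal B(\mathcal A)$. For $A\in\mathcal X$ put $hA=\{g\in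 Q:\mathsf P_g(A)=1\}$. The metric structure of a probability space $(\Omega,\mathcal F,\mu)$ is the quotient of the Boolean ring $(\mathcal F,\bigtriangleup,\cap)$ by the ideal of $\mu$-null sets, with the function induced by $\mu$ and the metric $\rho(a,b)=\mu(a\bigtriangleup b)$. Then: 1. $h$ maps $\mathcal X$ into $\mathcal B(Q)$ and is a homomorphism of $\sigma$-algebras: it preserves $\varnothing$, the whole space, complements, and finite and countable unions and intersections. 2. For every Borel probability measure $\mu$ on $Q$ and every $A\in\mathcal X$, $\mathsf P_\mu(A)=\mu(hA)$. 3. Suppose in addition that $\mathsf P_{g'}\perp\mathsf P_{g''}$ (as measures on $\mathcal B(\mathcal A)$) for all $g'\ne g''$ in $Q$. Then for every Borel probability measure $\mu$ on $Q$: (a) for every Borel set $B\subseteq Q$ there is $A\in\mathcal X$ with $\mu(B\bigtriangleup hA)=0$; (b) the metric structures of $(\mathcal A,\mathcal X,\mathsf P_\mu|_{\mathcal X})$ and $(Q,\mathcal B(Q),\mu)$ are isomorphic: $[A]\mapsto[hA]$ is a well-defined isomorphism of Boolean rings between them, and it preserves the measure and the metric. -/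

import Mathlib

open MeasureTheory ProbabilityTheory
open scoped ENNReal symmDiff

noncomputable section

namespace IndepMixture

/-! ### The metric structure of a measure space -/

section MetricStructure

variable {Ω : Type*} {m : MeasurableSpace Ω}

/-- The `σ`-algebra `m`, as the type of its members (a Boolean algebra). -/
abbrev SigmaAlg (m : MeasurableSpace Ω) : Type _ := {s : Set Ω // MeasurableSet[m] s}

/-- The ideal of negligible sets in the Boolean ring `(m, ∆, ∩)`. -/
def nullIdeal (μ : Measure[m] Ω) : Ideal (AsBoolRing (SigmaAlg m)) where
  carrier := {s | μ (ofBoolRing s : SigmaAlg m).1 = 0}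
  zero_mem' := by
    change μ (∅ : Set Ω) = 0
    simp
  add_mem' := by
    intro a b ha hb
    change μ ((ofBoolRing a : SigmaAlg m).1 ∆ (ofBoolRing b : SigmaAlg m).1) = 0
    refine measure_mono_null ?_ (measure_union_null ha hb)
    exact Set.symmDiff_subset_union
  smul_mem' := by
    intro c a ha
    change μ ((ofBoolRing c : SigmaAlg m).1 ∩ (ofBoolRing a : SigmaAlg m).1) = 0
    exact measure_mono_null Set.inter_subset_right ha

/-- The metric structure of `(Ω, m, μ)`: the Boolean ring of measurable sets (with addition `∆` and
multiplication `∩`) modulo the ideal of `μ`-negligible sets. -/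
def MetricStructure (μ : Measure[m] Ω) : Type _ := AsBoolRing (SigmaAlg m) ⧸ nullIdeal μ

instance (μ : Measure[m] Ω) : CommRing (MetricStructure μ) :=
  inferInstanceAs (CommRing (AsBoolRing (SigmaAlg m) ⧸ nullIdeal μ))

instance (μ : Measure[m] Ω) : BooleanRing (MetricStructure μ) where
  isIdempotentElem a := by
    obtain ⟨s, rfl⟩ := Ideal.Quotient.mk_surjective a
    change Ideal.Quotient.mk (nullIdeal μ) s * Ideal.Quotient.mk (nullIdeal μ) s = _
    rw [← map_mul, BooleanRing.mul_self]

namespace MetricStructure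

/-- The coset of a measurable set. -/
def mk (μ : Measure[m] Ω) (s : SigmaAlg m) : MetricStructure μ :=
  Ideal.Quotient.mk (nullIdeal μ) (toBoolRing s)

theorem mk_surjective (μ : Measure[m] Ω) : Function.Surjective (mk μ) := fun a => by
  obtain ⟨s, hs⟩ := Ideal.Quotient.mk_surjective a
  exact ⟨ofBoolRing s, hs⟩

theorem mk_eq_mk {μ : Measure[m] Ω} {s t : SigmaAlg m} :
    mk μ s = mk μ t ↔ μ (s.1 ∆ t.1) = 0 := by
  exact Ideal.Quotient.eq (I := nullIdeal μ) (x := toBoolRing s) (y := toBoolRing t)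

/-- The measure, as a function on cosets. -/
def measure (μ : Measure[m] Ω) (a : MetricStructure μ) : ℝ≥0∞ :=
  Quotient.liftOn' a (fun s => μ (ofBoolRing s : SigmaAlg m).1) (fun s t h => by
    have h' : μ ((ofBoolRing s : SigmaAlg m).1 ∆ (ofBoolRing t : SigmaAlg m).1) = 0 :=
      (Submodule.quotientRel_def _).1 h
    exact measure_congr (measure_symmDiff_eq_zero_iff.1 h'))

@[simp] theorem measure_mk (μ : Measure[m] Ω) (s : SigmaAlg m) : measure μ (mk μ s) = μ s.1 := rfl

theorem measure_mk_sub_mk (μ : Measure[m] Ω) (s t : SigmaAlg m) :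
    measure μ (mk μ s - mk μ t) = μ (s.1 ∆ t.1) := rfl

/-- The metric `ρ(a, b) = μ(a ∆ b)` on the metric structure (in a Boolean ring, the symmetric
difference is the sum, which is the same as the difference `a - b`). -/
instance (μ : Measure[m] Ω) [IsFiniteMeasure μ] : MetricSpace (MetricStructure μ) where
  dist a b := (measure μ (a - b)).toReal
  dist_self a := by
    obtain ⟨s, rfl⟩ := mk_surjective μ a
    rw [measure_mk_sub_mk]
    simp
  dist_comm a b := by
    obtain ⟨s, rfl⟩ := mk_surjective μ a
    obtain ⟨t, rfl⟩ := mk_surjective μ b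
    rw [measure_mk_sub_mk, measure_mk_sub_mk, symmDiff_comm]
  dist_triangle a b c := by
    obtain ⟨s, rfl⟩ := mk_surjective μ a
    obtain ⟨t, rfl⟩ := mk_surjective μ b
    obtain ⟨u, rfl⟩ := mk_surjective μ c
    simp only [measure_mk_sub_mk]
    rw [← ENNReal.toReal_add (by finiteness) (by finiteness)]
    exact ENNReal.toReal_mono (by finiteness) (measure_symmDiff_le _ _ _)
  eq_of_dist_eq_zero {a b} h := by
    obtain ⟨s, rfl⟩ := mk_surjective μ a
    obtain ⟨t, rfl⟩ := mk_surjective μ b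
    simp only [measure_mk_sub_mk] at h
    rw [mk_eq_mk]
    exact (ENNReal.toReal_eq_zero_iff _).1 h |>.resolve_right (by finiteness)

end MetricStructure

/-- Homomorphisms of `σ`-algebras: maps that commute with the finite and countable Boolean
operations. -/
structure IsSigmaHom {Ω' : Type*} {m' : MeasurableSpace Ω'}
    (h : SigmaAlg m → SigmaAlg m') : Prop where
  map_empty : h ⟨∅, MeasurableSet.empty⟩ = ⟨∅, MeasurableSet.empty⟩
  map_univ : h ⟨Set.univ, MeasurableSet.univ⟩ = ⟨Set.univ, MeasurableSet.univ⟩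
  map_compl : ∀ A : SigmaAlg m, (h ⟨A.1ᶜ, A.2.compl⟩).1 = (h A).1ᶜ
  map_union : ∀ A B : SigmaAlg m, (h ⟨A.1 ∪ B.1, A.2.union B.2⟩).1 = (h A).1 ∪ (h B).1
  map_inter : ∀ A B : SigmaAlg m, (h ⟨A.1 ∩ B.1, A.2.inter B.2⟩).1 = (h A).1 ∩ (h B).1
  map_iUnion : ∀ A : ℕ → SigmaAlg m,
    (h ⟨⋃ n, (A n).1, MeasurableSet.iUnion fun n => (A n).2⟩).1 = ⋃ n, (h (A n)).1
  map_iInter : ∀ A : ℕ → SigmaAlg m,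
    (h ⟨⋂ n, (A n).1, MeasurableSet.iInter fun n => (A n).2⟩).1 = ⋂ n, (h (A n)).1

end MetricStructure

/-! ### Independent distributions and their mixtures -/

/-- The space `𝒜 = ∏ j, {1, …, L j}` of sequences of outcomes. Its measurable space structure is the
product `σ`-algebra, that is, its Borel `σ`-algebra. -/
abbrev Outcomes (L : ℕ → ℕ) : Type := ∀ j : ℕ, Fin (L j)

/-- The space `ℝ^∞` of vectors `β = (β j l)`. -/
abbrev RInf (L : ℕ → ℕ) : Type := ∀ j : ℕ, Fin (L j) → ℝ

/-- The convex body `P ⊆ ℝ^∞` of sequences of probability vectors. -/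
def body (L : ℕ → ℕ) : Set (RInf L) :=
  {β | (∀ j l, 0 ≤ β j l ∧ β j l ≤ 1) ∧ ∀ j, ∑ l, β j l = 1}

/-- The distribution of the `j`-th variable: the value `l` has probability `β j l`. -/
def marginal {L : ℕ → ℕ} (β : RInf L) (j : ℕ) : Measure (Fin (L j)) :=
  ∑ l, ENNReal.ofReal (β j l) • Measure.dirac l

theorem marginal_apply {L : ℕ → ℕ} (β : RInf L) (j : ℕ) (s : Set (Fin (L j))) :
    marginal β j s = ∑ l, ENNReal.ofReal (β j l) * s.indicator 1 l := by
  simp [marginal]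

theorem isProbabilityMeasure_marginal {L : ℕ → ℕ} {β : RInf L} (hβ : β ∈ body L) (j : ℕ) :
    IsProbabilityMeasure (marginal β j) := by
  constructor
  rw [marginal_apply]
  simp only [Set.indicator_univ, Pi.one_apply, mul_one]
  rw [← ENNReal.ofReal_sum_of_nonneg fun l _ => (hβ.1 j l).1, hβ.2 j, ENNReal.ofReal_one]

/-- The independent distribution on `𝒜` with parameter `β`. -/
def indepDist {L : ℕ → ℕ} (β : RInf L) : Measure (Outcomes L) :=
  Measure.infinitePi (marginal β)

theorem isProbabilityMeasure_indepDist {L : ℕ → ℕ} {β : RInf L} (hβ : β ∈ body L) :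
    IsProbabilityMeasure (indepDist β) := by
  have := isProbabilityMeasure_marginal hβ
  unfold indepDist
  infer_instance

/-- The tail `σ`-algebra `⋂ n, σ(X_n, X_{n+1}, …)` on `𝒜`. -/
@[reducible] def tail (L : ℕ → ℕ) : MeasurableSpace (Outcomes L) :=
  ⨅ n : ℕ, ⨆ j : ℕ, ⨆ _ : n ≤ j,
    MeasurableSpace.comap (fun a : Outcomes L => a j) inferInstance

theorem tail_le (L : ℕ → ℕ) : tail L ≤ (MeasurableSpace.pi : MeasurableSpace (Outcomes L)) :=
  (iInf_le _ 0).trans <| iSup_le fun j => iSup_le fun _ => (measurable_pi_apply j).comap_le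

section Family

variable {L : ℕ → ℕ} {K : ℕ} (lam : Fin K → RInf L)

/-- The section `P₀` of the body `P` by the linear span of `λ¹, …, λᴷ`. -/
def sectionBody : Set (RInf L) := body L ∩ Submodule.span ℝ (Set.range lam)

/-- The vector `β(g) = ∑ k, g k • λᵏ`. -/
def param (g : EuclideanSpace ℝ (Fin K)) : RInf L := ∑ k, g k • lam k

/-- The set `Q ⊆ ℝᴷ` of coordinate vectors of the points of `P₀`. -/
def coordBody : Set (EuclideanSpace ℝ (Fin K)) := {g | param lam g ∈ sectionBody lam}

/-- The family `g ↦ P_g`, `g ∈ Q`, of independent distributions, as a Markov kernel. -/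
def family : Kernel (coordBody lam) (Outcomes L) where
  toFun g := indepDist (param lam g)
  measurable' := by
    have hp (g : coordBody lam) : param lam g ∈ body L := g.2.1
    have := fun g : coordBody lam => isProbabilityMeasure_indepDist (hp g)
    refine Measurable.measure_of_isPiSystem_of_isProbabilityMeasure
      (generateFrom_squareCylinders (α := fun j => Fin (L j))).symm
      (isPiSystem_squareCylinders (fun _ => MeasurableSpace.isPiSystem_measurableSet)
        (fun _ => MeasurableSet.univ (α := Fin (L _)))) ?_
    rintro _ ⟨s, t, ht, rfl⟩
    have h (g : coordBody lam) : indepDist (param lam g) ((s : Set ℕ).pi t) =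
        ∏ j ∈ s, ∑ l, ENNReal.ofReal (param lam g j l) * (t j).indicator 1 l := by
      have := isProbabilityMeasure_marginal (hp g)
      rw [indepDist, Measure.infinitePi_pi _ (t := t) (fun j _ => ht j (Set.mem_univ j))]
      simp only [marginal_apply]
    simp_rw [h]
    simp only [param, Finset.sum_apply, Pi.smul_apply]
    fun_prop

instance : IsMarkovKernel (family lam) :=
  ⟨fun g => isProbabilityMeasure_indepDist g.2.1⟩

/-- The mixture `P_μ(A) = ∫ P_g(A) μ(dg)`. -/
def mix (μ : Measure (coordBody lam)) : Measure (Outcomes L) := μ.bind (family lam)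

theorem mix_apply (μ : Measure (coordBody lam)) {A : Set (Outcomes L)} (hA : MeasurableSet A) :
    mix lam μ A = ∫⁻ g, family lam g A ∂μ :=
  Measure.bind_apply hA (family lam).aemeasurable

instance (μ : Measure (coordBody lam)) [IsProbabilityMeasure μ] :
    IsProbabilityMeasure (mix lam μ) := by
  unfold mix
  infer_instance

/-- The restriction of the mixture `P_μ` to the tail `σ`-algebra. -/
def tailMix (μ : Measure (coordBody lam)) : Measure[tail L] (Outcomes L) :=
  (mix lam μ).trim (tail_le L)

instance (μ : Measure (coordBody lam)) [IsProbabilityMeasure μ] :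
    IsProbabilityMeasure (tailMix lam μ) :=
  ⟨by rw [tailMix, trim_measurableSet_eq _ MeasurableSet.univ, measure_univ]⟩

/-- The map `h A = {g ∈ Q | P_g(A) = 1}` from the tail `σ`-algebra to the Borel `σ`-algebra
of `Q`. -/
def hMap (A : SigmaAlg (tail L)) :
    SigmaAlg (Subtype.instMeasurableSpace : MeasurableSpace (coordBody lam)) :=
  ⟨{g | family lam g A.1 = 1},
    (family lam).measurable_coe (tail_le L _ A.2) (measurableSet_singleton 1)⟩

end Family

end IndepMixture

end

noncomputable section

namespace IndepMixture

/-! ### The zero-one law and the homomorphism `h` -/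

section ZeroOne

variable {L : ℕ → ℕ}

/-! By the zero-one law each tail event has `P_g`-probability 0 or 1, so `g ↦ P_g(A)` is the
indicator of `hA`. This makes `h` a σ-homomorphism, gives `P_μ(A) = μ(hA)`, and makes `[A] ↦ [hA]`
an isometric, hence injective, ring homomorphism.

Under mutual singularity `h` is even onto (`hMap_surjective`). Its image is a σ-algebra, so it
suffices to reach the sets `{g_k ≤ t}`, and for this one needs a tail function equal to `g_k` almost
surely under every `P_g`. The key is the information form `info`. If `∑_j info_j(x,x)` converged for
some `x ≠ 0`, the barycentre and a small shift of it along `x` would give two members of the family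
whose likelihood ratio has bounded second moment, so they would not be singular
(`not_summable_info`). The information is therefore infinite in every direction, and by compactness
of the sphere uniformly so on finite blocks of indices beyond any `n`. Least squares on such a block
gives an unbiased estimator of `g_k` with variance at most a multiple of `2⁻ⁿ` (`exists_estimator`).
These estimators converge almost surely, and their limsup is tail measurable. -/

theorem iIndepFun_indepDist {β : RInf L} (hβ : β ∈ body L) {E : ℕ → Type*}
    [∀ j, MeasurableSpace (E j)] (u : ∀ j, Fin (L j) → E j) :
    iIndepFun (fun j (a : Outcomes L) => u j (a j)) (indepDist β) := by
  have := isProbabilityMeasure_marginal hβ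
  exact iIndepFun_infinitePi fun j => measurable_of_countable (u j)

/-- Kolmogorov's zero-one law for the independent distributions on `𝒜`. -/
theorem indepDist_eq_zero_or_one {β : RInf L} (hβ : β ∈ body L) {A : Set (Outcomes L)}
    (hA : MeasurableSet[tail L] A) : indepDist β A = 0 ∨ indepDist β A = 1 := by
  refine measure_zero_or_one_of_measurableSet_limsup_atTop
    (fun j => (measurable_pi_apply j).comap_le) (iIndepFun_indepDist hβ fun _ l => l) ?_
  rwa [Filter.limsup_eq_iInf_iSup_of_nat]

variable {K : ℕ} (lam : Fin K → RInf L)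

theorem family_eq_zero_or_one (g : coordBody lam) (A : SigmaAlg (tail L)) :
    family lam g A.1 = 0 ∨ family lam g A.1 = 1 :=
  indepDist_eq_zero_or_one g.2.1 A.2

variable {lam} in
theorem mem_hMap {A : SigmaAlg (tail L)} {g : coordBody lam} :
    g ∈ (hMap lam A).1 ↔ family lam g A.1 = 1 := Iff.rfl

-- The zero-one law enters the algebra of `h` only here: failing to have probability 1 means being
-- null.
variable {lam} in
theorem notMem_hMap {A : SigmaAlg (tail L)} {g : coordBody lam} :
    g ∉ (hMap lam A).1 ↔ family lam g A.1 = 0 := by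
  rw [mem_hMap]
  rcases family_eq_zero_or_one lam g A with h | h <;> simp [h]

theorem hMap_compl (A : SigmaAlg (tail L)) :
    (hMap lam ⟨A.1ᶜ, A.2.compl⟩).1 = (hMap lam A).1ᶜ := by
  ext g
  rw [Set.mem_compl_iff, notMem_hMap, mem_hMap, prob_compl_eq_one_iff (tail_le L _ A.2)]

/-- Passing to complements, a countable union is null exactly when each of its members is. -/
theorem hMap_iUnion {ι : Type*} [Countable ι] (A : ι → SigmaAlg (tail L)) :
    (hMap lam ⟨⋃ i, (A i).1, MeasurableSet.iUnion fun i => (A i).2⟩).1 =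
      ⋃ i, (hMap lam (A i)).1 := by
  ext g
  rw [← not_iff_not, notMem_hMap, Set.mem_iUnion, not_exists, measure_iUnion_null_iff]
  exact forall_congr' fun i => notMem_hMap.symm

theorem hMap_iInter {ι : Type*} [Countable ι] (A : ι → SigmaAlg (tail L)) :
    (hMap lam ⟨⋂ i, (A i).1, MeasurableSet.iInter fun i => (A i).2⟩).1 =
      ⋂ i, (hMap lam (A i)).1 := by
  have h := hMap_iUnion lam fun i => (⟨(A i).1ᶜ, (A i).2.compl⟩ : SigmaAlg (tail L))
  simp only [hMap_compl] at h
  rw [← compl_inj_iff, Set.compl_iInter, ← h, ← hMap_compl]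
  congr 2
  simp

theorem isSigmaHom_hMap : IsSigmaHom (hMap lam) where
  map_empty := by
    apply Subtype.ext
    ext g
    simp [hMap]
  map_univ := by
    apply Subtype.ext
    ext g
    simp [hMap]
  map_compl := hMap_compl lam
  map_union A B := by
    refine Eq.trans ?_ ((hMap_iUnion lam fun b : Bool => cond b A B).trans ?_)
    · refine congrArg (fun S => (hMap lam S).1) (Subtype.ext ?_)
      ext
      simp [or_comm]
    · ext
      simp [or_comm]
  map_inter A B := by
    refine Eq.trans ?_ ((hMap_iInter lam fun b : Bool => cond b A B).trans ?_)
    · refine congrArg (fun S => (hMap lam S).1) (Subtype.ext ?_)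
      ext
      simp [and_comm]
    · ext
      simp [and_comm]
  map_iUnion := hMap_iUnion lam
  map_iInter := hMap_iInter lam

theorem mix_eq_measure_hMap (μ : Measure (coordBody lam)) (A : SigmaAlg (tail L)) :
    mix lam μ A.1 = μ (hMap lam A).1 := by
  rw [mix_apply lam μ (tail_le L _ A.2), ← lintegral_indicator_one (hMap lam A).2]
  refine lintegral_congr fun g => ?_
  by_cases hg : g ∈ (hMap lam A).1
  · rw [Set.indicator_of_mem hg, mem_hMap.1 hg, Pi.one_apply]
  · rw [Set.indicator_of_notMem hg, notMem_hMap.1 hg]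

theorem hMap_symmDiff (A B : SigmaAlg (tail L)) :
    (hMap lam (A ∆ B)).1 = (hMap lam A).1 ∆ (hMap lam B).1 := by
  have h := isSigmaHom_hMap lam
  have e : A ∆ B = ⟨(A.1 ∩ B.1ᶜ) ∪ (B.1 ∩ A.1ᶜ),
    (A.2.inter B.2.compl).union (B.2.inter A.2.compl)⟩ := rfl
  rw [e, h.map_union ⟨_, A.2.inter B.2.compl⟩ ⟨_, B.2.inter A.2.compl⟩,
    h.map_inter A ⟨_, B.2.compl⟩, h.map_inter B ⟨_, A.2.compl⟩, h.map_compl, h.map_compl]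
  rfl

/-- The ring homomorphism `A ↦ [h A]`. -/
def hRingHom (μ : Measure (coordBody lam)) :
    AsBoolRing (SigmaAlg (tail L)) →+* MetricStructure μ where
  toFun A := MetricStructure.mk μ (hMap lam (ofBoolRing A))
  map_one' := congrArg (MetricStructure.mk μ) (isSigmaHom_hMap lam).map_univ
  map_zero' := congrArg (MetricStructure.mk μ) (isSigmaHom_hMap lam).map_empty
  map_mul' A B := congrArg (MetricStructure.mk μ) <| Subtype.ext <|
    (isSigmaHom_hMap lam).map_inter (ofBoolRing A) (ofBoolRing B)
  map_add' A B := congrArg (MetricStructure.mk μ) <| Subtype.ext <|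
    hMap_symmDiff lam (ofBoolRing A) (ofBoolRing B)

theorem tailMix_eq_measure_hMap (μ : Measure (coordBody lam)) (A : SigmaAlg (tail L)) :
    tailMix lam μ A.1 = μ (hMap lam A).1 := by
  rw [tailMix, trim_measurableSet_eq _ A.2, mix_eq_measure_hMap]

theorem hRingHom_eq_zero_of_mem (μ : Measure (coordBody lam))
    (A : AsBoolRing (SigmaAlg (tail L))) (hA : A ∈ nullIdeal (tailMix lam μ)) :
    hRingHom lam μ A = 0 := by
  refine Ideal.Quotient.eq_zero_iff_mem.2 ?_
  change μ (hMap lam (ofBoolRing A)).1 = 0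
  rw [← tailMix_eq_measure_hMap]
  exact hA

/-- The homomorphism of metric structures `[A] ↦ [h A]`. -/
def hMetricHom (μ : Measure (coordBody lam)) :
    MetricStructure (tailMix lam μ) →+* MetricStructure μ :=
  Ideal.Quotient.lift (nullIdeal (tailMix lam μ)) (hRingHom lam μ) (hRingHom_eq_zero_of_mem lam μ)

theorem hMetricHom_mk (μ : Measure (coordBody lam)) (A : SigmaAlg (tail L)) :
    hMetricHom lam μ (MetricStructure.mk _ A) = MetricStructure.mk μ (hMap lam A) := rfl

theorem measure_hMetricHom (μ : Measure (coordBody lam)) (a : MetricStructure (tailMix lam μ)) :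
    MetricStructure.measure μ (hMetricHom lam μ a) =
      MetricStructure.measure (tailMix lam μ) a := by
  obtain ⟨A, rfl⟩ := MetricStructure.mk_surjective _ a
  rw [hMetricHom_mk, MetricStructure.measure_mk, MetricStructure.measure_mk,
    tailMix_eq_measure_hMap]

theorem isometry_hMetricHom (μ : Measure (coordBody lam)) [IsProbabilityMeasure μ] :
    Isometry (hMetricHom lam μ) := by
  refine Isometry.of_dist_eq fun a b => ?_
  change (MetricStructure.measure μ _).toReal = (MetricStructure.measure _ _).toReal
  rw [← map_sub, measure_hMetricHom]

/-- Injectivity is free from the isometry; only surjectivity needs the approximation of Borel sets.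
-/
theorem hMetricHom_bijective (μ : Measure (coordBody lam)) [IsProbabilityMeasure μ]
    (h : ∀ B : Set (coordBody lam), MeasurableSet B →
      ∃ A : SigmaAlg (tail L), μ (B ∆ (hMap lam A).1) = 0) :
    Function.Bijective (hMetricHom lam μ) := by
  refine ⟨(isometry_hMetricHom lam μ).injective, fun b => ?_⟩
  obtain ⟨B, rfl⟩ := MetricStructure.mk_surjective μ b
  obtain ⟨A, hA⟩ := h B.1 B.2
  exact ⟨MetricStructure.mk _ A, (MetricStructure.mk_eq_mk.2 hA).symm⟩

end ZeroOne

/-! ### Product measures with square-integrable likelihood ratios -/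

section Likelihood

variable {L : ℕ → ℕ}

theorem marginal_singleton (β : RInf L) (j : ℕ) (l : Fin (L j)) :
    marginal β j {l} = ENNReal.ofReal (β j l) := by
  rw [marginal_apply, Finset.sum_eq_single l] <;> simp +contextual [Set.indicator]

theorem indepDist_real_cylinder {β : RInf L} (hβ : β ∈ body L) (s : Finset ℕ)
    (S : Finset (∀ j : s, Fin (L j))) :
    (indepDist β).real (cylinder s (S : Set (∀ j : s, Fin (L j)))) =
      ∑ y ∈ S, ∏ j : s, β j (y j) := by
  have := isProbabilityMeasure_marginal hβ
  rw [indepDist, measureReal_def, Measure.infinitePi_cylinder _ S.measurableSet,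
    ← sum_measure_singleton, ENNReal.toReal_sum (by finiteness)]
  refine Finset.sum_congr rfl fun y _ => ?_
  rw [Measure.pi_singleton, ENNReal.toReal_prod]
  refine Finset.prod_congr rfl fun j _ => ?_
  rw [marginal_singleton, ENNReal.toReal_ofReal (hβ.1 _ _).1]

/-- The Cauchy-Schwarz bound `Q(C)² ≤ D P(C)` for cylinders, where `D` bounds the second moment
of the likelihood ratio. -/
theorem indepDist_real_cylinder_sq_le {p q : RInf L} (hp : p ∈ body L) (hq : q ∈ body L)
    (hpq : ∀ j l, p j l = 0 → q j l = 0) {D : ℝ}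
    (hD : ∀ s : Finset ℕ, ∏ j ∈ s, ∑ l, q j l ^ 2 / p j l ≤ D) {C : Set (Outcomes L)}
    (hC : C ∈ measurableCylinders fun j => Fin (L j)) :
    (indepDist q).real C ^ 2 ≤ D * (indepDist p).real C := by
  classical
  obtain ⟨s, S, hS, rfl⟩ := (mem_measurableCylinders _).1 hC
  obtain ⟨S, rfl⟩ : ∃ T : Finset (∀ j : s, Fin (L j)), S = T := ⟨S.toFinset, by simp⟩
  rw [indepDist_real_cylinder hq, indepDist_real_cylinder hp]
  have hpos (y : ∀ j : s, Fin (L j)) : 0 ≤ ∏ j : s, p j (y j) :=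
    Finset.prod_nonneg fun j _ => (hp.1 _ _).1
  have hpos' (y : ∀ j : s, Fin (L j)) : 0 ≤ ∏ j : s, q j (y j) ^ 2 / p j (y j) :=
    Finset.prod_nonneg fun j _ => div_nonneg (sq_nonneg _) (hp.1 _ _).1
  refine (Finset.sum_sq_le_sum_mul_sum_of_sq_le_mul S
    (f := fun y => ∏ j : s, q j (y j) ^ 2 / p j (y j)) (fun y _ => hpos' y)
    (fun y _ => hpos y) fun y _ => ?_).trans
    (mul_le_mul_of_nonneg_right ?_ (Finset.sum_nonneg fun y _ => hpos y))
  · rw [← Finset.prod_mul_distrib, ← Finset.prod_pow]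
    refine (Finset.prod_congr rfl fun j _ => ?_).le
    -- The identity `q² = (q²/p) · p` survives `p = 0`, since then `q = 0` as well.
    by_cases h : p j (y j) = 0
    · simp [h, hpq _ _ h]
    · field_simp
  · refine le_trans ?_ (hD s)
    rw [← Finset.prod_coe_sort s, Fintype.prod_sum]
    exact Finset.sum_le_sum_of_subset_of_nonneg (Finset.subset_univ _) fun y _ _ => hpos' y

/-- One half of Kakutani's dichotomy. A cylinder close to a separating set would have `P(C) <
1/(4D)` and `Q(C) > 3/4`, contradicting `Q(C)² ≤ D P(C) < 1/4`. -/
theorem not_mutuallySingular_of_prod_le {p q : RInf L} (hp : p ∈ body L) (hq : q ∈ body L)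
    (hpq : ∀ j l, p j l = 0 → q j l = 0) {D : ℝ}
    (hD : ∀ s : Finset ℕ, ∏ j ∈ s, ∑ l, q j l ^ 2 / p j l ≤ D) :
    ¬ indepDist p ⟂ₘ indepDist q := by
  rintro ⟨N, hN, hpN, hqN⟩
  have := isProbabilityMeasure_indepDist hp
  have := isProbabilityMeasure_indepDist hq
  have hD0 : 1 ≤ D := by simpa using hD ∅
  -- Approximating under the sum of the two measures yields one cylinder that works for both.
  obtain ⟨C, hC, hCN⟩ := exists_measure_symmDiff_lt_of_generateFrom_isSetRing
    (μ := indepDist p + indepDist q) isSetRing_measurableCylinders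
    ⟨{Set.univ}, Set.countable_singleton _,
      Set.singleton_subset_iff.2 (univ_mem_measurableCylinders _), by simp⟩
    generateFrom_measurableCylinders.symm hN (ε := ENNReal.ofReal (1 / (4 * D)))
    (ENNReal.ofReal_pos.2 (by positivity))
  have key := indepDist_real_cylinder_sq_le hp hq hpq hD hC
  have hCm : MeasurableSet C := .of_mem_measurableCylinders hC
  have h1 : (indepDist p).real C < 1 / (4 * D) := by
    rw [measureReal_def]
    refine ENNReal.toReal_lt_of_lt_ofReal (lt_of_le_of_lt ?_ hCN)
    calc indepDist p C ≤ indepDist p (C ∆ N ∪ N) := measure_mono fun x hx => by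
            by_cases h : x ∈ N <;> simp [Set.mem_symmDiff, hx, h]
      _ ≤ indepDist p (C ∆ N) + indepDist p N := measure_union_le _ _
      _ ≤ _ := by rw [hpN, add_zero, Measure.add_apply]; exact le_self_add
  have h2 : (indepDist q).real Cᶜ < 1 / (4 * D) := by
    rw [measureReal_def]
    refine ENNReal.toReal_lt_of_lt_ofReal (lt_of_le_of_lt ?_ hCN)
    calc indepDist q Cᶜ ≤ indepDist q (C ∆ N ∪ Nᶜ) := measure_mono fun x hx => by
            by_cases h : x ∈ N <;> simp_all [Set.mem_symmDiff]
      _ ≤ indepDist q (C ∆ N) + indepDist q Nᶜ := measure_union_le _ _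
      _ ≤ _ := by rw [hqN, add_zero, Measure.add_apply]; exact le_add_self
  rw [probReal_compl_eq_one_sub hCm] at h2
  have h3 : 1 / (4 * D) ≤ 1 / 4 := by gcongr; linarith
  have h4 : D * (indepDist p).real C < 1 / 4 := by
    calc D * (indepDist p).real C < D * (1 / (4 * D)) := by gcongr
      _ = 1 / 4 := by field_simp
  nlinarith

end Likelihood

/-! ### Least-squares estimators of the coordinates -/

section Estimator

variable {L : ℕ → ℕ} {K : ℕ} (lam : Fin K → RInf L)

theorem param_apply (x : EuclideanSpace ℝ (Fin K)) (j : ℕ) (l : Fin (L j)) :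
    param lam x j l = ∑ k, x k * lam k j l := by
  simp [param, Finset.sum_apply]

theorem param_add (x y : EuclideanSpace ℝ (Fin K)) :
    param lam (x + y) = param lam x + param lam y := by
  simp [param, add_smul, Finset.sum_add_distrib]

theorem param_smul (c : ℝ) (x : EuclideanSpace ℝ (Fin K)) :
    param lam (c • x) = c • param lam x := by
  simp [param, mul_smul, Finset.smul_sum]

/-- The sum of the spanning vectors. -/
def total (j : ℕ) (l : Fin (L j)) : ℝ := ∑ k, lam k j l

/-- The Fisher information form of the `j`-th variable at the barycentre of the spanning vectors. -/
def info (j : ℕ) (x y : EuclideanSpace ℝ (Fin K)) : ℝ :=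
  ∑ l, param lam x j l * param lam y j l / total lam j l

variable {lam}

theorem family_apply (g : coordBody lam) : family lam g = indepDist (param lam g) := rfl

theorem param_mem_sectionBody {x : EuclideanSpace ℝ (Fin K)} (hx : param lam x ∈ body L) :
    param lam x ∈ sectionBody lam :=
  ⟨hx, Submodule.sum_mem _ fun k _ => Submodule.smul_mem _ _ (Submodule.subset_span ⟨k, rfl⟩)⟩

theorem continuous_info_self (j : ℕ) : Continuous fun x => info lam j x x := by
  simp only [info, param_apply]
  fun_prop

section Body

variable (hlam : ∀ k, lam k ∈ body L)
include hlam

theorem total_nonneg (j : ℕ) (l : Fin (L j)) : 0 ≤ total lam j l :=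
  Finset.sum_nonneg fun k _ => ((hlam k).1 j l).1

theorem sum_total (j : ℕ) : ∑ l, total lam j l = K := by
  simp only [total]
  rw [Finset.sum_comm]
  simp [(hlam _).2 j]

theorem sum_param (x : EuclideanSpace ℝ (Fin K)) (j : ℕ) :
    ∑ l, param lam x j l = ∑ k, x k := by
  simp only [param_apply]
  rw [Finset.sum_comm]
  simp [← Finset.mul_sum, (hlam _).2 j]

/-- Domination by `total` serves three purposes: vanishing where `total` does, positivity of small
shifts of the barycentre, and variance bounds for every `g` at once. -/
theorem abs_param_le (x : EuclideanSpace ℝ (Fin K)) (j : ℕ) (l : Fin (L j)) :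
    |param lam x j l| ≤ ‖x‖ * total lam j l := by
  rw [param_apply, total, Finset.mul_sum]
  refine (Finset.abs_sum_le_sum_abs _ _).trans (Finset.sum_le_sum fun k _ => ?_)
  have h := ((hlam k).1 j l).1
  rw [abs_mul, abs_of_nonneg h]
  exact mul_le_mul_of_nonneg_right (PiLp.norm_apply_le x k) h

theorem param_eq_zero {j : ℕ} {l : Fin (L j)} (h : total lam j l = 0)
    (x : EuclideanSpace ℝ (Fin K)) : param lam x j l = 0 := by
  simpa [h] using abs_param_le hlam x j l

theorem info_self_nonneg (j : ℕ) (x : EuclideanSpace ℝ (Fin K)) : 0 ≤ info lam j x x :=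
  Finset.sum_nonneg fun l _ => div_nonneg (mul_self_nonneg _) (total_nonneg hlam j l)

/-- Cauchy-Schwarz with weights `total`, whose mass is `K`. The lower bound does not depend on `j`,
so summable information forces the coordinates of `x` to sum to zero. -/
theorem sq_sum_le_info (j : ℕ) (x : EuclideanSpace ℝ (Fin K)) :
    (∑ k, x k) ^ 2 ≤ info lam j x x * K := by
  rw [← sum_param hlam x j, ← sum_total hlam j]
  refine Finset.sum_sq_le_sum_mul_sum_of_sq_le_mul _
    (fun l _ => div_nonneg (mul_self_nonneg _) (total_nonneg hlam j l))
    (fun l _ => total_nonneg hlam j l) fun l _ => ?_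
  by_cases h : total lam j l = 0
  · simp [h, param_eq_zero hlam h x]
  · field_simp
    rfl

/-- The parameters `β(c)` and `β(c + t x)`, with `c` the barycentre, have likelihood ratios whose
second moment is given by the information form. -/
theorem sum_sq_div_param (hK : 0 < K) {c x : EuclideanSpace ℝ (Fin K)} (hc : ∀ k, c k = 1 / K)
    (hx : ∑ k, x k = 0) (t : ℝ) (j : ℕ) :
    ∑ l, param lam (c + t • x) j l ^ 2 / param lam c j l = 1 + K * t ^ 2 * info lam j x x := by
  have hK' : (0 : ℝ) < K := by exact_mod_cast hK
  have hcp (l : Fin (L j)) : param lam c j l = total lam j l / K := by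
    simp only [param_apply, hc, ← Finset.mul_sum, total]
    ring
  -- Expand the square around `total / K`; the linear term disappears after summation because `∑ x_k
  -- = 0`.
  have h (l : Fin (L j)) : param lam (c + t • x) j l ^ 2 / param lam c j l =
      total lam j l / K + 2 * t * param lam x j l +
        K * t ^ 2 * (param lam x j l * param lam x j l / total lam j l) := by
    rw [param_add, param_smul, Pi.add_apply, Pi.add_apply, hcp]
    by_cases h : total lam j l = 0
    · simp [h, param_eq_zero hlam h x]
    · simp only [Pi.smul_apply, smul_eq_mul]
      field_simp
      ring
  simp only [h, Finset.sum_add_distrib, ← Finset.mul_sum, ← Finset.sum_div, sum_param hlam,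
    sum_total hlam, hx, info]
  field_simp
  ring

theorem mem_coordBody_of_nonneg {y : EuclideanSpace ℝ (Fin K)}
    (h0 : ∀ j l, 0 ≤ param lam y j l) (h1 : ∑ k, y k = 1) : y ∈ coordBody lam := by
  refine param_mem_sectionBody ⟨fun j l => ⟨h0 j l, ?_⟩, fun j => (sum_param hlam y j).trans h1⟩
  rw [← h1, ← sum_param hlam y j]
  exact Finset.single_le_sum (fun l _ => h0 j l) (Finset.mem_univ l)

theorem prod_sum_sq_div_param_le (hK : 0 < K) {c x : EuclideanSpace ℝ (Fin K)}
    (hc : ∀ k, c k = 1 / K) (hx : ∑ k, x k = 0) (t : ℝ) (hs : Summable fun j => info lam j x x)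
    (s : Finset ℕ) :
    ∏ j ∈ s, ∑ l, param lam (c + t • x) j l ^ 2 / param lam c j l ≤
      Real.exp (K * t ^ 2 * ∑' j, info lam j x x) := by
  simp only [sum_sq_div_param hlam hK hc hx]
  calc ∏ j ∈ s, (1 + K * t ^ 2 * info lam j x x)
      ≤ ∏ j ∈ s, Real.exp (K * t ^ 2 * info lam j x x) := by
        refine Finset.prod_le_prod (fun j _ => ?_) fun j _ => ?_
        · have := info_self_nonneg hlam j x
          positivity
        · rw [add_comm]
          exact Real.add_one_le_exp _
    _ = Real.exp (K * t ^ 2 * ∑ j ∈ s, info lam j x x) := by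
        rw [← Real.exp_sum, Finset.mul_sum]
    _ ≤ _ := by
        gcongr
        exact hs.sum_le_tsum s fun j _ => info_self_nonneg hlam j x

theorem sum_eq_zero_of_summable_info {x : EuclideanSpace ℝ (Fin K)}
    (hs : Summable fun j => info lam j x x) : ∑ k, x k = 0 := by
  have hlim := hs.tendsto_atTop_zero.mul_const (K : ℝ)
  rw [zero_mul] at hlim
  have := ge_of_tendsto' hlim fun j => sq_sum_le_info hlam j x
  exact pow_eq_zero_iff two_ne_zero |>.1 (le_antisymm this (sq_nonneg _))

theorem not_summable_info
    (hsing : ∀ g' g'' : coordBody lam, g' ≠ g'' → family lam g' ⟂ₘ family lam g'')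
    {x : EuclideanSpace ℝ (Fin K)} (hx : x ≠ 0) : ¬ Summable fun j => info lam j x x := by
  intro hs
  have hK : 0 < K := by
    by_contra! h
    obtain rfl : K = 0 := by omega
    exact hx (Subsingleton.elim _ _)
  have hK' : (0 : ℝ) < K := by exact_mod_cast hK
  have hx0 := sum_eq_zero_of_summable_info hlam hs
  have hxn : 0 < ‖x‖ := norm_pos_iff.2 hx
  -- With `t‖x‖ = 1/K`, the shift `t β(x)` is at most `total / K = β(c)` in absolute value, so `c +
  -- t x` remains in `Q`.
  obtain ⟨t, ht0, ht⟩ : ∃ t : ℝ, 0 < t ∧ t * ‖x‖ = 1 / K :=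
    ⟨1 / (K * ‖x‖), by positivity, by field_simp⟩
  obtain ⟨c, hc⟩ : ∃ c : EuclideanSpace ℝ (Fin K), ∀ k, c k = 1 / (K : ℝ) :=
    ⟨WithLp.toLp 2 fun _ => 1 / (K : ℝ), fun _ => rfl⟩
  have hcp (j) (l : Fin (L j)) : param lam c j l = total lam j l / K := by
    simp only [param_apply, hc, ← Finset.mul_sum, total]
    ring
  have hcs : ∑ k, c k = 1 := by simp [hc, hK'.ne']
  have hcm : c ∈ coordBody lam := mem_coordBody_of_nonneg hlam
    (fun j l => by rw [hcp]; exact div_nonneg (total_nonneg hlam j l) hK'.le) hcs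
  have hdm : c + t • x ∈ coordBody lam := by
    refine mem_coordBody_of_nonneg hlam (fun j l => ?_) ?_
    · rw [param_add, param_smul]
      simp only [Pi.add_apply, Pi.smul_apply, smul_eq_mul, hcp]
      have h := mul_le_mul_of_nonneg_left (neg_le_of_abs_le (abs_param_le hlam x j l)) ht0.le
      have h' : total lam j l / K = t * (‖x‖ * total lam j l) := by
        rw [← mul_assoc, ht]
        ring
      rw [h']
      linarith
    · simp only [PiLp.add_apply, PiLp.smul_apply, Finset.sum_add_distrib, hcs, smul_eq_mul,
        ← Finset.mul_sum, hx0, mul_zero, add_zero]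
  have hne : (⟨c, hcm⟩ : coordBody lam) ≠ ⟨c + t • x, hdm⟩ := fun h => by
    simpa [ht0.ne', hx] using congrArg Subtype.val h
  have hs' := hsing _ _ hne
  rw [family_apply, family_apply] at hs'
  refine not_mutuallySingular_of_prod_le hcm.1 hdm.1 (fun j l h => ?_)
    (prod_sum_sq_div_param_le hlam hK hc hx0 t hs) hs'
  rw [hcp, div_eq_zero_iff, or_iff_left hK'.ne'] at h
  exact param_eq_zero hlam h _

/-- The partial sums are continuous, increase with `N` and diverge at each nonzero `x`, so
compactness of the unit sphere gives one `N` for all directions; homogeneity of degree 2 does the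
rest. -/
theorem exists_le_sum_info
    (hsing : ∀ g' g'' : coordBody lam, g' ≠ g'' → family lam g' ⟂ₘ family lam g'')
    (n : ℕ) (R : ℝ) : ∃ N, ∀ x, R * ‖x‖ ^ 2 ≤ ∑ j ∈ Finset.Ico n N, info lam j x x := by
  let U (N : ℕ) : Set (EuclideanSpace ℝ (Fin K)) :=
    {x | R < ∑ j ∈ Finset.Ico n N, info lam j x x}
  have hU : Monotone U := fun N N' h x hx => lt_of_lt_of_le hx <|
    Finset.sum_le_sum_of_subset_of_nonneg (Finset.Ico_subset_Ico_right h)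
      fun j _ _ => info_self_nonneg hlam j x
  obtain ⟨N, hN⟩ := (isCompact_sphere (0 : EuclideanSpace ℝ (Fin K)) 1).elim_directed_cover U
    (fun N => isOpen_lt continuous_const
      (continuous_finsetSum _ fun j _ => continuous_info_self j))
    (fun x hx => by
      have hx0 : x ≠ 0 := ne_zero_of_mem_unit_sphere ⟨x, hx⟩
      have h := (not_summable_iff_tendsto_nat_atTop_of_nonneg
        fun j => info_self_nonneg hlam j x).1 (not_summable_info hlam hsing hx0)
      obtain ⟨N, hN, hnN⟩ := ((h.eventually_gt_atTop
        (R + ∑ j ∈ Finset.range n, info lam j x x)).and (Filter.eventually_ge_atTop n)).exists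
      refine Set.mem_iUnion.2 ⟨N, ?_⟩
      change R < _
      rw [Finset.sum_Ico_eq_sub _ hnN]
      linarith) hU.directed_le
  refine ⟨N, fun x => ?_⟩
  by_cases hx : x = 0
  · simp [hx, info, param_apply]
  have hxn : 0 < ‖x‖ := norm_pos_iff.2 hx
  have h := hN (show ‖x‖⁻¹ • x ∈ Metric.sphere 0 1 by simp [norm_smul, hxn.ne'])
  have h' (j : ℕ) : info lam j (‖x‖⁻¹ • x) (‖x‖⁻¹ • x) = info lam j x x * (‖x‖ ^ 2)⁻¹ := by
    simp only [info, param_smul, Pi.smul_apply, smul_eq_mul, Finset.sum_mul]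
    refine Finset.sum_congr rfl fun l _ => ?_
    rw [sq, mul_inv]
    ring
  simp only [U, Set.mem_ofPred_eq, h', ← Finset.sum_mul] at h
  rw [← div_eq_mul_inv] at h
  exact ((lt_div_iff₀ (by positivity)).1 h).le

end Body

/-- The Riesz representation of a functional by a coercive form. -/
theorem exists_form_eq_of_coercive {V : Type*} [NormedAddCommGroup V] [NormedSpace ℝ V]
    [FiniteDimensional ℝ V] (B : V →ₗ[ℝ] V →ₗ[ℝ] ℝ) {R : ℝ} (hR : 0 < R)
    (hB : ∀ x, R * ‖x‖ ^ 2 ≤ B x x) (f : V →ₗ[ℝ] ℝ) (hf : ∀ x, |f x| ≤ ‖x‖) :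
    ∃ w, B w = f ∧ B w w ≤ 1 / R := by
  have hinj : Function.Injective B := by
    rw [← LinearMap.ker_eq_bot, LinearMap.ker_eq_bot']
    intro x hx
    have h := hB x
    rw [hx, LinearMap.zero_apply] at h
    have : ‖x‖ ^ 2 ≤ 0 := by
      by_contra! h'
      nlinarith [mul_pos hR h']
    exact norm_eq_zero.1 (pow_eq_zero_iff two_ne_zero |>.1 (le_antisymm this (sq_nonneg _)))
  obtain ⟨w, hw⟩ := (LinearMap.injective_iff_surjective_of_finrank_eq_finrank
    (Subspace.dual_finrank_eq (K := ℝ) (V := V)).symm).1 hinj f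
  refine ⟨w, hw, ?_⟩
  -- Here `R‖w‖² ≤ B w w = f w ≤ ‖w‖`, so `‖w‖ ≤ 1/R`, which bounds `B w w` in turn.
  have h1 := hB w
  have h2 := (le_abs_self _).trans (hf w)
  rw [hw] at h1 ⊢
  rw [le_div_iff₀ hR]
  obtain h0 | h0 := (norm_nonneg w).eq_or_lt
  · nlinarith
  · have : R * ‖w‖ ≤ 1 := by
      by_contra! h
      nlinarith
    nlinarith

/-- Coordinates have unbiased estimators of arbitrarily small variance that depend on finitely many
variables with indices beyond any given bound. -/
theorem exists_estimator (hlam : ∀ k, lam k ∈ body L)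
    (hsing : ∀ g' g'' : coordBody lam, g' ≠ g'' → family lam g' ⟂ₘ family lam g'')
    (k : Fin K) (n : ℕ) {ε : ℝ} (hε : 0 < ε) :
    ∃ (N : ℕ) (u : ∀ j, Fin (L j) → ℝ),
      (∀ x, ∑ j ∈ Finset.Ico n N, ∑ l, param lam x j l * u j l = x k) ∧
      ∑ j ∈ Finset.Ico n N, ∑ l, total lam j l * u j l ^ 2 ≤ ε := by
  obtain ⟨N, hN⟩ := exists_le_sum_info hlam hsing n (1 / ε)
  let B : EuclideanSpace ℝ (Fin K) →ₗ[ℝ] EuclideanSpace ℝ (Fin K) →ₗ[ℝ] ℝ :=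
    LinearMap.mk₂ ℝ (fun x y => ∑ j ∈ Finset.Ico n N, info lam j x y)
      (fun x x' y => by
        simp only [info, param_add, Pi.add_apply, add_mul, add_div, Finset.sum_add_distrib])
      (fun c x y => by
        simp only [info, param_smul, Pi.smul_apply, smul_eq_mul, mul_assoc, mul_div_assoc,
          Finset.mul_sum])
      (fun x y y' => by
        simp only [info, param_add, Pi.add_apply, mul_add, add_div, Finset.sum_add_distrib])
      (fun c x y => by
        simp only [info, param_smul, Pi.smul_apply, smul_eq_mul, mul_left_comm _ c, mul_div_assoc,
          Finset.mul_sum])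
  obtain ⟨w, hw, hw'⟩ := exists_form_eq_of_coercive B (one_div_pos.2 hε) hN
    (EuclideanSpace.proj k : EuclideanSpace ℝ (Fin K) →L[ℝ] ℝ).toLinearMap
    (fun x => PiLp.norm_apply_le x k)
  -- The weights come from the Riesz vector `w` of the `k`-th coordinate: unbiasedness is `B w x =
  -- x_k`, and the weighted square sum is `B w w`.
  refine ⟨N, fun j l => param lam w j l / total lam j l, fun x => ?_, ?_⟩
  · refine Eq.trans ?_ (LinearMap.congr_fun hw x)
    refine Finset.sum_congr rfl fun j _ => Finset.sum_congr rfl fun l _ => ?_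
    ring
  · rw [one_div_one_div] at hw'
    refine le_of_eq_of_le ?_ hw'
    refine Finset.sum_congr rfl fun j _ => Finset.sum_congr rfl fun l _ => ?_
    by_cases h : total lam j l = 0
    · simp [h]
    · field_simp

end Estimator

/-! ### Tail-measurable recovery of the parameter -/

section Recovery

open Filter Topology

/-- Random variables with a common mean and summable variances converge to that mean. -/
theorem ae_tendsto_of_summable_variance {Ω : Type*} {m : MeasurableSpace Ω} {P : Measure Ω}
    [IsProbabilityMeasure P] {X : ℕ → Ω → ℝ} (hX : ∀ n, MemLp (X n) 2 P) {c : ℝ}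
    (hc : ∀ n, ∫ ω, X n ω ∂P = c) (hs : Summable fun n => Var[X n; P]) :
    ∀ᵐ ω ∂P, Tendsto (fun n => X n ω) atTop (𝓝 c) := by
  have hm (n : ℕ) : AEMeasurable (fun ω => ‖X n ω - c‖ₑ ^ 2) P :=
    ((hX n).1.aemeasurable.sub_const c).enorm.pow_const 2
  -- The squared deviations have finite total expectation, so almost surely they are summable and
  -- tend to zero.
  have h : ∫⁻ ω, ∑' n, ‖X n ω - c‖ₑ ^ 2 ∂P ≠ ⊤ := by
    rw [lintegral_tsum hm]
    have e (n : ℕ) : ∫⁻ ω, ‖X n ω - c‖ₑ ^ 2 ∂P = ENNReal.ofReal Var[X n; P] := by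
      rw [(hX n).ofReal_variance_eq, evariance, hc n]
    simp only [e]
    rw [← ENNReal.ofReal_tsum_of_nonneg (fun n => variance_nonneg _ _) hs]
    exact ENNReal.ofReal_ne_top
  filter_upwards [ae_lt_top' (AEMeasurable.tsum hm) h] with ω hω
  have h0 := ENNReal.tendsto_atTop_zero_of_tsum_ne_top hω.ne
  rw [tendsto_iff_edist_tendsto_0]
  have h1 := h0.ennrpow_const (1 / 2)
  refine (h1.congr fun n => ?_).trans (by simp)
  rw [edist_eq_enorm_sub, ← ENNReal.rpow_natCast, ← ENNReal.rpow_mul]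
  simp

variable {L : ℕ → ℕ}

theorem integral_indepDist {β : RInf L} (hβ : β ∈ body L) (j : ℕ) (u : Fin (L j) → ℝ) :
    ∫ a, u (a j) ∂indepDist β = ∑ l, β j l * u l := by
  have := isProbabilityMeasure_marginal hβ
  have h := integral_map (μ := indepDist β) (measurable_pi_apply j).aemeasurable
    (measurable_of_countable u).aestronglyMeasurable
  rw [← h, indepDist, Measure.infinitePi_map_eval, integral_fintype .of_finite]
  refine Finset.sum_congr rfl fun l _ => ?_
  rw [measureReal_def, marginal_singleton, ENNReal.toReal_ofReal (hβ.1 _ _).1, smul_eq_mul]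

theorem memLp_indepDist {β : RInf L} (hβ : β ∈ body L) (j : ℕ) (u : Fin (L j) → ℝ) :
    MemLp (fun a : Outcomes L => u (a j)) 2 (indepDist β) := by
  have := isProbabilityMeasure_indepDist hβ
  refine MemLp.of_bound ((measurable_of_countable u).comp
    (measurable_pi_apply j)).aestronglyMeasurable (∑ l, ‖u l‖) (ae_of_all _ fun a => ?_)
  exact Finset.single_le_sum (f := fun l => ‖u l‖) (fun l _ => norm_nonneg _)
    (Finset.mem_univ (a j))

theorem variance_sum_indepDist_le {β : RInf L} (hβ : β ∈ body L) (s : Finset ℕ)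
    (u : ∀ j, Fin (L j) → ℝ) :
    Var[fun a : Outcomes L => ∑ j ∈ s, u j (a j); indepDist β] ≤
      ∑ j ∈ s, ∑ l, β j l * u j l ^ 2 := by
  have := isProbabilityMeasure_indepDist hβ
  have h := IndepFun.variance_sum (μ := indepDist β) (s := s)
    (X := fun j (a : Outcomes L) => u j (a j)) (fun j _ => memLp_indepDist hβ j (u j))
    fun i _ j _ hij => (iIndepFun_indepDist hβ u).indepFun hij
  have e : (fun a : Outcomes L => ∑ j ∈ s, u j (a j)) =
      ∑ j ∈ s, fun a : Outcomes L => u j (a j) := by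
    ext a
    simp
  rw [e, h]
  refine Finset.sum_le_sum fun j _ => ?_
  refine (variance_le_expectation_sq (memLp_indepDist hβ j (u j)).1).trans_eq ?_
  exact integral_indepDist hβ j fun l => u j l ^ 2

variable {K : ℕ} {lam : Fin K → RInf L}

/-- Each coordinate of `g` is the almost sure limit of statistics `U n` that depend only on the
variables with indices at least `n`. -/
theorem exists_consistent_statistic (hlam : ∀ k, lam k ∈ body L)
    (hsing : ∀ g' g'' : coordBody lam, g' ≠ g'' → family lam g' ⟂ₘ family lam g'') (k : Fin K) :
    ∃ (N : ℕ → ℕ) (u : ℕ → ∀ j, Fin (L j) → ℝ), ∀ g : coordBody lam, ∀ᵐ a ∂family lam g,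
      Tendsto (fun n => ∑ j ∈ Finset.Ico n (N n), u n j (a j)) atTop (𝓝 (g.1 k)) := by
  -- The geometric choice of `ε` makes the variances summable; the statistics themselves do not
  -- depend on `g`.
  choose N u hu hu' using fun n : ℕ =>
    exists_estimator hlam hsing k n (ε := (1 / 2 : ℝ) ^ n) (by positivity)
  refine ⟨N, u, fun g => ?_⟩
  have hβ : param lam g ∈ body L := g.2.1
  rw [family_apply]
  have := isProbabilityMeasure_indepDist hβ
  refine ae_tendsto_of_summable_variance (fun n => ?_) (fun n => ?_) ?_
  · exact memLp_finsetSum _ fun j _ => memLp_indepDist hβ j (u n j)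
  · rw [integral_finsetSum _ fun j _ => (memLp_indepDist hβ j (u n j)).integrable one_le_two]
    simp only [integral_indepDist hβ, hu]
  · refine .of_nonneg_of_le (fun n => variance_nonneg _ _) (fun n => ?_)
      (summable_geometric_two.mul_left ‖g.1‖)
    refine (variance_sum_indepDist_le hβ _ _).trans
      (le_trans ?_ (mul_le_mul_of_nonneg_left (hu' n) (norm_nonneg _)))
    simp only [Finset.mul_sum]
    refine Finset.sum_le_sum fun j _ => Finset.sum_le_sum fun l _ => ?_
    rw [← mul_assoc]
    exact mul_le_mul_of_nonneg_right ((le_abs_self _).trans (abs_param_le hlam g.1 j l))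
      (sq_nonneg _)

/-- A limsup ignores finitely many terms, and after dropping `m` of them only coordinates with index
at least `m` occur. -/
theorem measurable_tail_limsup {E : Type*} [CompleteLinearOrder E] [TopologicalSpace E]
    [OrderTopology E] [SecondCountableTopology E] [MeasurableSpace E] [BorelSpace E]
    {U : ℕ → Outcomes L → E}
    (hU : ∀ n, Measurable[⨆ j : ℕ, ⨆ _ : n ≤ j,
      MeasurableSpace.comap (fun a : Outcomes L => a j) inferInstance] (U n)) :
    Measurable[tail L] fun a => limsup (fun n => U n a) atTop := by
  intro s hs
  refine MeasurableSpace.measurableSet_iInf.2 fun m => ?_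
  have h : Measurable[⨆ j : ℕ, ⨆ _ : m ≤ j,
      MeasurableSpace.comap (fun a : Outcomes L => a j) inferInstance]
      fun a => limsup (fun n => U (n + m) a) atTop :=
    Measurable.limsup fun n => (hU (n + m)).mono
      (iSup_mono fun j => iSup_mono' fun h => ⟨(Nat.le_add_left m n).trans h, le_rfl⟩) le_rfl
  simp only [fun a => limsup_nat_add (fun n => U n a) m] at h
  exact h hs

theorem exists_hMap_eq_coord_le (hlam : ∀ k, lam k ∈ body L)
    (hsing : ∀ g' g'' : coordBody lam, g' ≠ g'' → family lam g' ⟂ₘ family lam g'') (k : Fin K)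
    (t : ℝ) : ∃ A : SigmaAlg (tail L), (hMap lam A).1 = {g | g.1 k ≤ t} := by
  obtain ⟨N, u, hu⟩ := exists_consistent_statistic hlam hsing k
  -- Values in `EReal` make the limsup meaningful at every point, including where the statistics
  -- diverge.
  have hT : Measurable[tail L] fun a : Outcomes L =>
      limsup (fun n => ((∑ j ∈ Finset.Ico n (N n), u n j (a j) : ℝ) : EReal)) atTop := by
    refine measurable_tail_limsup fun n => measurable_coe_real_ereal.comp ?_
    refine Finset.measurable_fun_sum _ fun j hj => (measurable_of_countable (u n j)).comp ?_
    exact (comap_measurable fun a : Outcomes L => a j).mono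
      (le_iSup₂_of_le j (Finset.mem_Ico.1 hj).1 le_rfl) le_rfl
  refine ⟨⟨_, hT (measurableSet_Iic (a := (t : EReal)))⟩, ?_⟩
  ext g
  have hlim : ∀ᵐ a ∂family lam g,
      limsup (fun n => ((∑ j ∈ Finset.Ico n (N n), u n j (a j) : ℝ) : EReal)) atTop = g.1 k := by
    filter_upwards [hu g] with a ha
    exact ((continuous_coe_real_ereal.tendsto _).comp ha).limsup_eq
  rw [mem_hMap, ← mem_ae_iff_prob_eq_one (tail_le L _ (hT measurableSet_Iic))]
  change (∀ᵐ a ∂family lam g, _ ≤ (t : EReal)) ↔ g.1 k ≤ t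
  -- The limsup is the constant `g_k` almost surely under `P_g`, for every `g`, so the two sets
  -- agree exactly and not merely up to null sets.
  refine (eventually_congr (hlim.mono fun a ha => ?_)).trans eventually_const
  rw [ha, EReal.coe_le_coe_iff]

/-- If the distributions are pairwise mutually singular, then `h` is onto. -/
theorem hMap_surjective (hlam : ∀ k, lam k ∈ body L)
    (hsing : ∀ g' g'' : coordBody lam, g' ≠ g'' → family lam g' ⟂ₘ family lam g'') :
    Function.Surjective (hMap lam) := by
  -- The image of `h` is a σ-algebra; once the coordinates are measurable for it, it contains every
  -- Borel set of `Q`.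
  let M : MeasurableSpace (coordBody lam) :=
    { MeasurableSet' := fun B => ∃ A : SigmaAlg (tail L), (hMap lam A).1 = B
      measurableSet_empty := ⟨_, congrArg Subtype.val (isSigmaHom_hMap lam).map_empty⟩
      measurableSet_compl := by
        rintro _ ⟨A, rfl⟩
        exact ⟨_, hMap_compl lam A⟩
      measurableSet_iUnion := fun B hB => by
        choose A hA using hB
        exact ⟨_, (hMap_iUnion lam A).trans (Set.iUnion_congr hA)⟩ }
  have hk (k : Fin K) : Measurable[M] fun g : coordBody lam => g.1 k :=
    measurable_of_Iic fun t => exists_hMap_eq_coord_le hlam hsing k t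
  have hval : Measurable[M] (Subtype.val : coordBody lam → EuclideanSpace ℝ (Fin K)) :=
    (PiLp.continuous_toLp 2 _).measurable.comp (measurable_pi_iff.2 hk)
  rintro ⟨B, hB⟩
  obtain ⟨A, hA⟩ : MeasurableSet[M] B := measurable_iff_comap_le.1 hval B hB
  exact ⟨A, Subtype.ext hA⟩

end Recovery

end IndepMixture

theorem mainTheorem3 (L : ℕ → ℕ) (K : ℕ) (lam : Fin K → IndepMixture.RInf L)
    (hlam : ∀ k, lam k ∈ IndepMixture.body L) (hind : LinearIndependent ℝ lam) :
    IndepMixture.IsSigmaHom (IndepMixture.hMap lam) ∧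
    (∀ (μ : Measure (IndepMixture.coordBody lam)) [IsProbabilityMeasure μ]
      (A : IndepMixture.SigmaAlg (IndepMixture.tail L)),
      IndepMixture.mix lam μ A.1 = μ (IndepMixture.hMap lam A).1) ∧
    ((∀ g' g'' : IndepMixture.coordBody lam, g' ≠ g'' →
        IndepMixture.family lam g' ⟂ₘ IndepMixture.family lam g'') →
      ∀ (μ : Measure (IndepMixture.coordBody lam)) [IsProbabilityMeasure μ],
        (∀ B : Set (IndepMixture.coordBody lam), MeasurableSet B →
          ∃ A : IndepMixture.SigmaAlg (IndepMixture.tail L),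
            μ (B ∆ (IndepMixture.hMap lam A).1) = 0) ∧
        ∃ φ : IndepMixture.MetricStructure (IndepMixture.tailMix lam μ) ≃+*
            IndepMixture.MetricStructure μ,
          (∀ A : IndepMixture.SigmaAlg (IndepMixture.tail L),
            φ (IndepMixture.MetricStructure.mk (IndepMixture.tailMix lam μ) A) =
              IndepMixture.MetricStructure.mk μ (IndepMixture.hMap lam A)) ∧
          (∀ a, IndepMixture.MetricStructure.measure μ (φ a) =
            IndepMixture.MetricStructure.measure (IndepMixture.tailMix lam μ) a) ∧
          Isometry φ) := by
  refine ⟨IndepMixture.isSigmaHom_hMap lam,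
    fun μ _ A => IndepMixture.mix_eq_measure_hMap lam μ A, fun hsing μ _ => ?_⟩
  have h (B : Set (IndepMixture.coordBody lam)) (hB : MeasurableSet B) :
      ∃ A : IndepMixture.SigmaAlg (IndepMixture.tail L),
        μ (B ∆ (IndepMixture.hMap lam A).1) = 0 := by
    obtain ⟨A, hA⟩ := IndepMixture.hMap_surjective hlam hsing ⟨B, hB⟩
    exact ⟨A, by simp [hA]⟩
  exact ⟨h, RingEquiv.ofBijective _ (IndepMixture.hMetricHom_bijective lam μ h),
    IndepMixture.hMetricHom_mk lam μ, IndepMixture.measure_hMetricHom lam μ,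
    IndepMixture.isometry_hMetricHom lam μ⟩

end
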